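/- Let $p\in(0,1]$ and $c\ge 0$. Consider the Markov decision process with states $(x,y)$, $x\in\{0,1,2,\dots\}$ (age of the update in the memory), $y\in\{1,2,3,\dots\}$ (age of the sampled update at the client), actions $a\in\{0,1\}$ ($a=1$: sample the memory, $a=0$: idle), one-slot cost $y+ca$, and transitions $$(x,y)\to\begin{cases}(0,x+1)&\text{with probability }p,\\(x+1,x+1)&\text{with probability }1-p,\end{cases}\quad\text{if }a=1,\qquad (x,y)\to\begin{cases}(0,y+1)&\text{with probability }p,\\(x+1,y+1)&\text{with probability }1-p,\end{cases}\quad\text{if }a=0.$$ For a policy $\pi$ and an initial state $s$ let $g_\pi(s)=\limsup_{T\to\infty}\frac1T\,\mathbb E_\pi\big[\sum_{t=0}^{T-1}(y(t)+c\,a(t))\,\big|\,s(0)=s\big]\in[0,\infty]$. A stationary deterministic policy $\pi^*$ is average-cost optimal if $g_{\pi^*}(s)=\inf_\pi g_\pi(s)$ for every state $s$, the infimum being over all (possibly history-dependent and randomized) policies. A stationary deterministic policy has threshold $Y$ if in the states $(0,y)$ it samples exactly when $y\ge Y$. Let $$Y'=\sqrt{2c+\Big(\frac1p-\frac12\Big)^2}-\Big(\frac1p-\frac12\Big),\qquad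 Y_0^*=\lceil Y'\rceil .$$ Theorem. The policy that samples in the states $(0,y)$ with $y\ge Y_0^*$ and idles in all other states is average-cost optimal, and its average cost is finite and does not depend on the initial state. Moreover, for every integer $Y\ge1$, there is an average-cost optimal stationary deterministic policy with threshold $Y$ if and only if $Y=Y_0^*$, or $Y'$ is an integer and $Y=Y_0^*+1$. (For $c=0$ one has $Y_0^*=0$, and the thresholds $0$ and $1$ describe the same behaviour in the states $(0,y)$, because $y\ge 1$.) -/

import Mathlib

open scoped ENNReal NNReal

namespace MemorySampling

/-- A state `(x, y)`: `x ∈ {0, 1, 2, …}` is the age of the update held in the memory and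
`y ∈ {1, 2, 3, …}` is the age of the sampled update at the client. -/
abbrev State : Type := ℕ × ℕ+

/-- The action of the reader in a slot: `true` means read (sample the memory, `a = 1`), `false`
means stay idle (`a = 0`). -/
abbrev Action : Type := Bool

/-- The one-slot cost `C((x, y); a) = y + c a`. -/
noncomputable def cost (c : ℝ) (s : State) (a : Action) : ℝ :=
  ((s.2 : ℕ) : ℝ) + c * (if a then 1 else 0)

/-- The law of the indicator that the writer commits a fresh update at the end of a slot: `true`
has probability `p` and `false` has probability `1 - p`. -/
noncomputable def writeLaw (p : unitInterval) : PMF Bool :=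
  PMF.ofFintype (fun w => if w then ENNReal.ofReal (p : ℝ) else ENNReal.ofReal (1 - (p : ℝ))) (by
    rw [Fintype.sum_bool]
    simp only [if_true, Bool.false_eq_true, if_false]
    rw [← ENNReal.ofReal_add p.2.1 (sub_nonneg.2 p.2.2)]
    simp)

/-- The state after one slot, given the action `a` and the indicator `w` of a write. The age at the
client becomes `x + 1` after a read and `y + 1` after an idle slot; the age in the memory becomes
`0` if there is a write and `x + 1` otherwise. -/
def nextState (s : State) (a : Action) (w : Bool) : State :=
  (if w then 0 else s.1 + 1, if a then Nat.succPNat s.1 else s.2 + 1)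

/-- The transition law `P(· ∣ s, a)`: probability `p` for a write, `1 - p` for no write. -/
noncomputable def transition (p : unitInterval) (s : State) (a : Action) : PMF State :=
  (writeLaw p).map (nextState s a)

/-- The past of a trajectory: the list of the state-action pairs of all earlier slots, the most
recent one first. -/
abbrev History : Type := List (State × Action)

/-- A general (history-dependent, randomized) policy: from the past state-action pairs and the
current state it gives the distribution of the current action. -/
abbrev Policy : Type := History → State → PMF Action

/-- The general policy given by a stationary deterministic policy `π : S → A`. -/
noncomputable def stationary (π : State → Action) : Policy :=
  fun _ s => PMF.pure (π s)

/-- The joint law of the past (slots `0, …, t - 1`) and of the state in slot `t`, when the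
system starts in `s₀` and the policy `π` is used. -/
noncomputable def trajectoryLaw (p : unitInterval) (π : Policy) (s₀ : State) :
    ℕ → PMF (History × State)
  | 0 => PMF.pure ([], s₀)
  | t + 1 =>
    (trajectoryLaw p π s₀ t).bind fun hs =>
      (π hs.1 hs.2).bind fun a =>
        (transition p hs.2 a).map fun s' => ((hs.2, a) :: hs.1, s')

/-- The total cost along a history. -/
noncomputable def totalCost (c : ℝ) (h : History) : ℝ :=
  (h.map fun sa => cost c sa.1 sa.2).sum

/-- The expected total cost `𝔼_π [∑_{t < T} (y(t) + c a(t))]` of the first `T` slots. The values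
are extended nonnegative reals, the costs being nonnegative for `c ≥ 0`. -/
noncomputable def expectedTotalCost (p : unitInterval) (c : ℝ) (π : Policy) (s₀ : State)
    (T : ℕ) : ℝ≥0∞ :=
  ∑' hs : History × State, trajectoryLaw p π s₀ T hs * ENNReal.ofReal (totalCost c hs.1)

/-- The expected average cost
`g_π(s₀) = limsup_{T → ∞} (1 / T) 𝔼_π [∑_{t < T} (y(t) + c a(t))]`. -/
noncomputable def averageCost (p : unitInterval) (c : ℝ) (π : Policy) (s₀ : State) : ℝ≥0∞ :=
  Filter.limsup (fun T : ℕ => expectedTotalCost p c π s₀ T / (T : ℝ≥0∞)) Filter.atTop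

/-- The stationary deterministic policy `π` is average-cost optimal: from every initial state its
average cost is the least one among all policies, including history-dependent randomized ones. -/
def IsAverageCostOptimal (p : unitInterval) (c : ℝ) (π : State → Action) : Prop :=
  ∀ s : State, ∀ π' : Policy, averageCost p c (stationary π) s ≤ averageCost p c π' s

/-- In the states `(0, y)`, the policy `π` samples exactly when `y ≥ Y`. -/
def HasThreshold (π : State → Action) (Y : ℕ) : Prop :=
  ∀ y : ℕ+, π (0, y) = true ↔ Y ≤ (y : ℕ)

/-- The threshold policy: sample in the states `(0, y)` with `y ≥ Y`, stay idle in all other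
states. -/
def thresholdPolicy (Y : ℕ) : State → Action :=
  fun s => decide (s.1 = 0 ∧ Y ≤ (s.2 : ℕ))

end MemorySampling

/-! The proof is a verification argument with an explicit solution of the average-cost optimality
equation. By renewal-reward, threshold `n + 1` has cycles of mean length `n + 1/p`, and `gain` is
mean cycle cost over mean cycle length. Write `f` for `bias` at this gain `g`. Sampling in `(x, y)`
costs `c` and then behaves like idling at age `x`, so the relative value is `y + min (f y) (f x +
c)`. With `f 0 = 0`, the choice in `(0, y)` compares `f y` with `c`. Everything rests on `n + 1/p ≤
g ≤ n + 1 + 1/p`, that is `f n ≤ c ≤ f (n + 1)`; since `c = Y'/p + Y'(Y' - 1)/2`, this amounts to `n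
≤ Y' ≤ n + 1`.

`value_subsolution` gives the lower bound `g` for all policies, and `thresholdValue_poisson` shows
that the threshold policy attains it. For uniqueness, a wrong threshold takes a strictly losing
action in `(0, Y - 1)` or `(0, Y)`, a state it visits with positive frequency;
`lt_averageCost_of_loss` turns this into a strictly larger average. Both actions tie in `(0, n + 1)`
exactly when `f (n + 1) = c`, i.e. `Y' = n + 1`. -/

open Filter Topology

namespace MemorySampling

/-! ### Expectations along trajectories -/

section Expectation

theorem tsum_bind_mul {α β : Type*} (μ : PMF α) (κ : α → PMF β) (F : β → ℝ≥0∞) :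
    ∑' b, μ.bind κ b * F b = ∑' a, μ a * ∑' b, κ a b * F b := by
  simp only [PMF.bind_apply, ← ENNReal.tsum_mul_right, ← ENNReal.tsum_mul_left, mul_assoc]
  exact ENNReal.tsum_comm

theorem tsum_pure_mul {α : Type*} (a : α) (F : α → ℝ≥0∞) :
    ∑' b, PMF.pure a b * F b = F a := by
  rw [tsum_eq_single a]
  · simp
  · intro b hb
    simp [PMF.pure_apply, hb]

theorem tsum_map_mul {α β : Type*} (μ : PMF α) (φ : α → β) (F : β → ℝ≥0∞) :
    ∑' b, μ.map φ b * F b = ∑' a, μ a * F (φ a) := by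
  rw [PMF.map, tsum_bind_mul]
  simp only [Function.comp, tsum_pure_mul]

theorem tsum_writeLaw_mul (p : unitInterval) (F : Bool → ℝ≥0∞) :
    ∑' w, writeLaw p w * F w =
      ENNReal.ofReal (p : ℝ) * F true + ENNReal.ofReal (1 - (p : ℝ)) * F false := by
  rw [tsum_fintype, Fintype.sum_bool]
  simp [writeLaw]

/-- The expectation of a nonnegative function of the history and the state in slot `t`. -/
noncomputable def expect (p : unitInterval) (π : Policy) (s₀ : State) (t : ℕ)
    (F : History × State → ℝ≥0∞) : ℝ≥0∞ :=
  ∑' hs, trajectoryLaw p π s₀ t hs * F hs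

variable {p : unitInterval} {π : Policy} {s₀ : State} {t : ℕ}

theorem expect_zero (F : History × State → ℝ≥0∞) : expect p π s₀ 0 F = F ([], s₀) :=
  tsum_pure_mul _ _

theorem expect_succ (F : History × State → ℝ≥0∞) :
    expect p π s₀ (t + 1) F = expect p π s₀ t fun hs =>
      ∑' a, π hs.1 hs.2 a *
        (ENNReal.ofReal (p : ℝ) * F ((hs.2, a) :: hs.1, nextState hs.2 a true) +
          ENNReal.ofReal (1 - (p : ℝ)) * F ((hs.2, a) :: hs.1, nextState hs.2 a false)) := by
  simp only [expect, trajectoryLaw, transition, tsum_bind_mul, tsum_map_mul, tsum_writeLaw_mul]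

theorem expect_mono {F G : History × State → ℝ≥0∞} (h : ∀ hs, F hs ≤ G hs) :
    expect p π s₀ t F ≤ expect p π s₀ t G :=
  ENNReal.tsum_le_tsum fun hs => mul_le_mul_right (h hs) _

theorem expect_add (F G : History × State → ℝ≥0∞) :
    (expect p π s₀ t fun hs => F hs + G hs) = expect p π s₀ t F + expect p π s₀ t G := by
  simp only [expect, mul_add, ENNReal.tsum_add]

theorem expect_const_mul (k : ℝ≥0∞) (F : History × State → ℝ≥0∞) :
    (expect p π s₀ t fun hs => k * F hs) = k * expect p π s₀ t F := by
  simp only [expect, ← ENNReal.tsum_mul_left, mul_left_comm]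

theorem expect_const (k : ℝ≥0∞) : (expect p π s₀ t fun _ => k) = k := by
  rw [expect, ENNReal.tsum_mul_right, PMF.tsum_coe, one_mul]

end Expectation

/-! ### Verification: average-cost bounds from sub- and supersolutions -/

section Cost

variable {c : ℝ}

theorem cost_nonneg (hc : 0 ≤ c) (s : State) (a : Action) : 0 ≤ cost c s a := by
  unfold cost
  split_ifs <;> positivity

theorem age_le_cost (hc : 0 ≤ c) (s : State) (a : Action) : ((s.2 : ℕ) : ℝ) ≤ cost c s a := by
  unfold cost
  split_ifs <;> simp [hc]

theorem totalCost_nonneg (hc : 0 ≤ c) (h : History) : 0 ≤ totalCost c h := by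
  apply List.sum_nonneg
  simp only [List.mem_map]
  rintro _ ⟨sa, -, rfl⟩
  exact cost_nonneg hc _ _

theorem totalCost_cons (sa : State × Action) (h : History) :
    totalCost c (sa :: h) = cost c sa.1 sa.2 + totalCost c h := by
  simp [totalCost]

/-- The expectation of `h` at the state that follows `s` under the action `a`. -/
noncomputable def nextMean (p : ℝ) (h : State → ℝ) (s : State) (a : Action) : ℝ :=
  p * h (nextState s a true) + (1 - p) * h (nextState s a false)

variable {p : unitInterval} {π : Policy} {s₀ : State}

theorem expectedTotalCost_eq_expect (T : ℕ) :
    expectedTotalCost p c π s₀ T =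
      expect p π s₀ T fun hs => ENNReal.ofReal (totalCost c hs.1) := rfl

theorem ofReal_totalCost_add_nextMean (hc : 0 ≤ c) {h : State → ℝ} (hh : ∀ s, 0 ≤ h s)
    (l : History) (s : State) (a : Action) :
    ENNReal.ofReal (p : ℝ) *
        ENNReal.ofReal (totalCost c ((s, a) :: l) + h (nextState s a true)) +
      ENNReal.ofReal (1 - (p : ℝ)) *
        ENNReal.ofReal (totalCost c ((s, a) :: l) + h (nextState s a false)) =
      ENNReal.ofReal (totalCost c l + (cost c s a + nextMean p h s a)) := by
  have hp := p.2.1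
  have hp' : 0 ≤ 1 - (p : ℝ) := sub_nonneg.2 p.2.2
  have h1 := totalCost_nonneg hc ((s, a) :: l)
  have h2 := hh (nextState s a true)
  have h3 := hh (nextState s a false)
  rw [← ENNReal.ofReal_mul hp, ← ENNReal.ofReal_mul hp', ← ENNReal.ofReal_add (by positivity)
    (by positivity), totalCost_cons, nextMean]
  congr 1
  ring

theorem tsum_policy_mul_const (l : History) (s : State) (k : ℝ≥0∞) :
    ∑' a, π l s a * k = k := by
  rw [ENNReal.tsum_mul_right, PMF.tsum_coe, one_mul]

/-- Telescoping of the one-step inequality. It is needed only for actions that `π` can take, so the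
lemma serves both arbitrary policies and one fixed stationary policy. -/
theorem expect_totalCost_add_ge (hc : 0 ≤ c) {h : State → ℝ} (hh : ∀ s, 0 ≤ h s) {γ : ℝ}
    (hγ : 0 ≤ γ)
    (hsub : ∀ l s a, π l s a ≠ 0 → γ + h s ≤ cost c s a + nextMean p h s a) (T : ℕ) :
    ENNReal.ofReal γ * T ≤
      expect p π s₀ T fun hs => ENNReal.ofReal (totalCost c hs.1 + h hs.2) := by
  induction T with
  | zero => simp
  | succ T ih =>
    rw [expect_succ]
    simp only [ofReal_totalCost_add_nextMean hc hh]
    calc ENNReal.ofReal γ * ((T + 1 : ℕ) : ℝ≥0∞)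
        = ENNReal.ofReal γ * T + ENNReal.ofReal γ := by push_cast; ring
      _ ≤ (expect p π s₀ T fun hs => ENNReal.ofReal (totalCost c hs.1 + h hs.2)) +
            expect p π s₀ T fun _ => ENNReal.ofReal γ := by
          rw [expect_const]; gcongr
      _ ≤ _ := by
          rw [← expect_add]
          refine expect_mono fun hs => ?_
          rw [← tsum_policy_mul_const (π := π) hs.1 hs.2 (_ + _)]
          refine ENNReal.tsum_le_tsum fun a => ?_
          by_cases ha : π hs.1 hs.2 a = 0
          · simp [ha]
          · refine mul_le_mul_right ?_ _
            rw [← ENNReal.ofReal_add (add_nonneg (totalCost_nonneg hc _) (hh _)) hγ]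
            exact ENNReal.ofReal_le_ofReal (by linarith [hsub hs.1 hs.2 a ha])

theorem expect_totalCost_add_le (hc : 0 ≤ c) {h : State → ℝ} (hh : ∀ s, 0 ≤ h s) {γ : ℝ}
    (hγ : 0 ≤ γ)
    (hsup : ∀ l s a, π l s a ≠ 0 → cost c s a + nextMean p h s a ≤ γ + h s) (T : ℕ) :
    (expect p π s₀ T fun hs => ENNReal.ofReal (totalCost c hs.1 + h hs.2)) ≤
      ENNReal.ofReal γ * T + ENNReal.ofReal (h s₀) := by
  induction T with
  | zero => simp [expect_zero, totalCost]
  | succ T ih =>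
    rw [expect_succ]
    simp only [ofReal_totalCost_add_nextMean hc hh]
    calc _ ≤ (expect p π s₀ T fun hs => ENNReal.ofReal (totalCost c hs.1 + h hs.2)) +
            expect p π s₀ T fun _ => ENNReal.ofReal γ := by
          rw [← expect_add]
          refine expect_mono fun hs => ?_
          rw [← tsum_policy_mul_const (π := π) hs.1 hs.2 (_ + _)]
          refine ENNReal.tsum_le_tsum fun a => ?_
          by_cases ha : π hs.1 hs.2 a = 0
          · simp [ha]
          · refine mul_le_mul_right ?_ _
            rw [← ENNReal.ofReal_add (add_nonneg (totalCost_nonneg hc _) (hh _)) hγ]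
            exact ENNReal.ofReal_le_ofReal (by linarith [hsup hs.1 hs.2 a ha])
      _ ≤ (ENNReal.ofReal γ * T + ENNReal.ofReal (h s₀)) + ENNReal.ofReal γ := by
          rw [expect_const]; gcongr
      _ = ENNReal.ofReal γ * ((T + 1 : ℕ) : ℝ≥0∞) + ENNReal.ofReal (h s₀) := by
          push_cast; ring

theorem expectedTotalCost_add_age_le (hc : 0 ≤ c) (T : ℕ) :
    expectedTotalCost p c π s₀ T +
        (expect p π s₀ T fun hs => ENNReal.ofReal ((hs.2.2 : ℕ) : ℝ)) ≤
      expectedTotalCost p c π s₀ (T + 1) := by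
  have key := fun l s a => ofReal_totalCost_add_nextMean (p := p) hc (h := fun _ => 0)
    (fun _ => le_rfl) l s a
  simp only [add_zero, nextMean, mul_zero] at key
  rw [expectedTotalCost_eq_expect, expectedTotalCost_eq_expect, expect_succ, ← expect_add]
  simp only [key]
  refine expect_mono fun hs => ?_
  rw [← tsum_policy_mul_const (π := π) hs.1 hs.2 (_ + _)]
  refine ENNReal.tsum_le_tsum fun a => mul_le_mul_right ?_ _
  rw [← ENNReal.ofReal_add (totalCost_nonneg hc _) (by positivity)]
  exact ENNReal.ofReal_le_ofReal (by linarith [age_le_cost hc hs.2 a])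

/-- If the partial sums `C` grow at least by `Y` and `γ T ≤ C T + K (Y T + 1)`, then the averages
of `C` have an upper limit of at least `γ`: otherwise `Y` would grow linearly. -/
theorem le_limsup_div_of_le_add {C Y : ℕ → ℝ≥0∞} {γ K : ℝ} (hγ : 0 ≤ γ) (hK : 0 ≤ K)
    (hC : ∀ T, C T + Y T ≤ C (T + 1))
    (h : ∀ T : ℕ, ENNReal.ofReal γ * T ≤ C T + ENNReal.ofReal K * (Y T + 1)) :
    ENNReal.ofReal γ ≤ limsup (fun T : ℕ => C T / (T : ℝ≥0∞)) atTop := by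
  by_contra! hlt
  obtain ⟨δ, hδ1, hδ2⟩ := ENNReal.lt_iff_exists_nnreal_btwn.1 hlt
  have hδγ : (δ : ℝ) < γ := by
    rw [ENNReal.ofReal, ENNReal.coe_lt_coe] at hδ2
    have := NNReal.coe_lt_coe.2 hδ2
    rwa [Real.coe_toNNReal _ hγ] at this
  obtain ⟨T₀, hT₀⟩ := eventually_atTop.1 (eventually_lt_of_limsup_lt hδ1)
  have hCle : ∀ T, T₀ + 1 ≤ T → C T ≤ δ * T := fun T hT => by
    have hT0 : (T : ℝ≥0∞) ≠ 0 := by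
      have : T ≠ 0 := by omega
      exact_mod_cast this
    exact (ENNReal.div_le_iff hT0 (ENNReal.natCast_ne_top T)).1 (hT₀ T (by omega)).le
  have hCtop : ∀ T, T₀ + 1 ≤ T → C T ≠ ⊤ := fun T hT =>
    ne_top_of_le_ne_top (ENNReal.mul_ne_top ENNReal.coe_ne_top (ENNReal.natCast_ne_top T))
      (hCle T hT)
  have hYtop : ∀ T, T₀ + 1 ≤ T → Y T ≠ ⊤ := fun T hT =>
    ne_top_of_le_ne_top (hCtop (T + 1) (by omega)) (le_trans le_add_self (hC T))
  have r1 : ∀ T, T₀ + 1 ≤ T → (C T).toReal ≤ δ * T := fun T hT => by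
    have := ENNReal.toReal_mono (ENNReal.mul_ne_top ENNReal.coe_ne_top
      (ENNReal.natCast_ne_top T)) (hCle T hT)
    simpa using this
  have r2 : ∀ T, T₀ + 1 ≤ T → (C T).toReal + (Y T).toReal ≤ (C (T + 1)).toReal := fun T hT => by
    rw [← ENNReal.toReal_add (hCtop T hT) (hYtop T hT)]
    exact ENNReal.toReal_mono (hCtop _ (by omega)) (hC T)
  have r3 : ∀ T, T₀ + 1 ≤ T → γ * T ≤ (C T).toReal + K * ((Y T).toReal + 1) := fun T hT => by
    have hY1 : Y T + 1 ≠ ⊤ := ENNReal.add_ne_top.2 ⟨hYtop T hT, ENNReal.one_ne_top⟩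
    have hKY : ENNReal.ofReal K * (Y T + 1) ≠ ⊤ := ENNReal.mul_ne_top ENNReal.ofReal_ne_top hY1
    have := ENNReal.toReal_mono (ENNReal.add_ne_top.2 ⟨hCtop T hT, hKY⟩) (h T)
    rw [ENNReal.toReal_add (hCtop T hT) hKY, ENNReal.toReal_mul, ENNReal.toReal_mul,
      ENNReal.toReal_ofReal hγ, ENNReal.toReal_ofReal hK,
      ENNReal.toReal_add (hYtop T hT) ENNReal.one_ne_top] at this
    simpa using this
  have hpos : 0 < γ - δ := sub_pos.2 hδγ
  -- Beyond `N`, having `Y T < γ` would give `γ T ≤ δ T + K γ + K`, which is false. So the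
  -- increments of `C` are eventually at least `γ > δ`, contradicting `C T ≤ δ T`.
  obtain ⟨N, hN⟩ := exists_nat_gt ((K * γ + K) / (γ - δ))
  rw [div_lt_iff₀ hpos] at hN
  set T₁ := max N (T₀ + 1) with hT₁
  have r4 : ∀ T, T₁ ≤ T → γ ≤ (Y T).toReal := fun T hT => by
    by_contra! hlt'
    have hT' : T₀ + 1 ≤ T := le_trans (le_max_right _ _) hT
    have hNT : (N : ℝ) ≤ T := by exact_mod_cast le_trans (le_max_left _ _) hT
    nlinarith [r1 T hT', r3 T hT', mul_le_mul_of_nonneg_left hlt'.le hK]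
  have r5 : ∀ k : ℕ, γ * k ≤ (C (T₁ + k)).toReal := fun k => by
    induction k with
    | zero => simp
    | succ k ih =>
      have h1 := r2 (T₁ + k) (by omega)
      have h2 := r4 (T₁ + k) (by omega)
      rw [← add_assoc]
      push_cast
      linarith
  obtain ⟨k, hk⟩ := exists_nat_gt (δ * T₁ / (γ - δ))
  rw [div_lt_iff₀ hpos] at hk
  have h1 := r1 (T₁ + k) (by omega)
  have h2 := r5 k
  push_cast at h1
  nlinarith

/-- A subsolution of the optimality equation with at most linear growth bounds the average cost
from below. -/
theorem le_averageCost_of_subsolution (hc : 0 ≤ c) {h : State → ℝ} (hh : ∀ s, 0 ≤ h s)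
    {γ K : ℝ} (hγ : 0 ≤ γ) (hK : 0 ≤ K) (hlin : ∀ s : State, h s ≤ K * (((s.2 : ℕ) : ℝ) + 1))
    (hsub : ∀ l s a, π l s a ≠ 0 → γ + h s ≤ cost c s a + nextMean p h s a) :
    ENNReal.ofReal γ ≤ averageCost p c π s₀ := by
  refine le_limsup_div_of_le_add hγ hK (fun T => expectedTotalCost_add_age_le hc T) fun T => ?_
  refine (expect_totalCost_add_ge (s₀ := s₀) hc hh hγ hsub T).trans ?_
  rw [expectedTotalCost_eq_expect, ← expect_const (p := p) (π := π) (s₀ := s₀) (t := T) 1,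
    ← expect_add, ← expect_const_mul, ← expect_add]
  refine expect_mono fun hs => ?_
  rw [← ENNReal.ofReal_one, ← ENNReal.ofReal_add (by positivity) zero_le_one,
    ← ENNReal.ofReal_mul hK,
    ← ENNReal.ofReal_add (totalCost_nonneg hc _) (by positivity)]
  exact ENNReal.ofReal_le_ofReal (by linarith [hlin hs.2])

/-- A nonnegative supersolution of the Poisson equation bounds the average cost from above. -/
theorem averageCost_le_of_supersolution (hc : 0 ≤ c) {h : State → ℝ} (hh : ∀ s, 0 ≤ h s)
    {γ : ℝ} (hγ : 0 ≤ γ)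
    (hsup : ∀ l s a, π l s a ≠ 0 → cost c s a + nextMean p h s a ≤ γ + h s) :
    averageCost p c π s₀ ≤ ENNReal.ofReal γ := by
  have hlim : Tendsto (fun T : ℕ => ENNReal.ofReal γ + ENNReal.ofReal (h s₀) / (T : ℝ≥0∞)) atTop
      (𝓝 (ENNReal.ofReal γ)) := by
    simpa using tendsto_const_nhds.add
      (ENNReal.Tendsto.const_div ENNReal.tendsto_nat_nhds_top
        (Or.inr (ENNReal.ofReal_ne_top (r := h s₀))))
  rw [← hlim.limsup_eq]
  refine limsup_le_limsup ?_
  filter_upwards [eventually_gt_atTop 0] with T hT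
  have hT0 : (T : ℝ≥0∞) ≠ 0 := by exact_mod_cast hT.ne'
  have hle : expectedTotalCost p c π s₀ T ≤
      ENNReal.ofReal γ * T + ENNReal.ofReal (h s₀) :=
    (expect_mono fun hs => ENNReal.ofReal_le_ofReal (by linarith [hh hs.2])).trans
      (expect_totalCost_add_le hc hh hγ hsup T)
  calc expectedTotalCost p c π s₀ T / T
      ≤ (ENNReal.ofReal γ * T + ENNReal.ofReal (h s₀)) / T := ENNReal.div_le_div_right hle _
    _ = _ := by
      rw [ENNReal.add_div, ENNReal.mul_div_cancel_right hT0 (ENNReal.natCast_ne_top T)]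

end Cost

/-! ### The one-dimensional waiting problem -/

section Bias

/-- The average cost of the threshold policy with threshold `n + 1`. -/
noncomputable def gain (p c : ℝ) (n : ℕ) : ℝ :=
  (n * (n - 1) / 2 + (1 + 1 / p) * n + c + (1 / p) ^ 2) / (n + 1 / p)

/-- The excess over `y` of the relative value of idling up to the next write when the age at the
client is `y`, for the average cost `g` and the threshold `n + 1`. -/
noncomputable def bias (p c g : ℝ) (n y : ℕ) : ℝ :=
  if y ≤ n then (g - 1) * y - y * (y - 1) / 2 else c + (y + 1 / p - g) * (1 / p)

variable {p c : ℝ} {n : ℕ}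

theorem gain_mul (hp : 0 < p) :
    gain p c n * (n + 1 / p) = n * (n - 1) / 2 + (1 + 1 / p) * n + c + (1 / p) ^ 2 := by
  have : (0 : ℝ) < n + 1 / p := by positivity
  rw [gain, div_mul_cancel₀ _ this.ne']

theorem gain_sub_lower (hp : 0 < p) :
    (gain p c n - (n + 1 / p)) * (n + 1 / p) = c - (n * (1 / p) + n * (n - 1) / 2) := by
  linear_combination gain_mul (c := c) (n := n) hp

theorem upper_sub_gain (hp : 0 < p) :
    (n + 1 + 1 / p - gain p c n) * (n + 1 / p) = ((n + 1) * (1 / p) + (n + 1) * n / 2) - c := by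
  linear_combination -gain_mul (c := c) (n := n) hp

theorem bias_zero {g : ℝ} : bias p c g n 0 = 0 := by
  simp [bias]

theorem bias_of_le {g : ℝ} {y : ℕ} (h : y ≤ n) :
    bias p c g n y = (g - 1) * y - y * (y - 1) / 2 := if_pos h

/-- At `y = n` the quadratic and the linear branch agree; this matching condition is exactly the
formula for `gain`. -/
theorem bias_of_ge (hp : 0 < p) {y : ℕ} (h : n ≤ y) :
    bias p c (gain p c n) n y = c + (y + 1 / p - gain p c n) * (1 / p) := by
  rcases h.eq_or_lt with rfl | h
  · rw [bias_of_le le_rfl]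
    linear_combination gain_mul (c := c) (n := n) hp
  · exact if_neg (by omega)

variable (hp : 0 < p) (hp1 : p ≤ 1) (hl : n + 1 / p ≤ gain p c n)
  (hu : gain p c n ≤ n + 1 + 1 / p)

include hp hl

theorem gain_nonneg : 0 ≤ gain p c n := le_trans (by positivity) hl

include hp1

/-- The increment at `y < n` is `g - 1 - y`, nonnegative because `g ≥ n + 1/p ≥ n + 1`; from `n` on
it is `1/p`. -/
theorem bias_monotone : Monotone (bias p c (gain p c n) n) := by
  refine monotone_nat_of_le_succ fun y => ?_
  have h1 : 1 ≤ 1 / p := by rwa [le_div_iff₀ hp, one_mul]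
  rcases lt_or_ge y n with h | h
  · have h2 : ((y + 1 : ℕ) : ℝ) ≤ n := by exact_mod_cast h
    rw [bias_of_le h.le, bias_of_le (y := y + 1) h]
    push_cast at *
    linarith
  · rw [bias_of_ge hp h, bias_of_ge hp (y := y + 1) (by omega)]
    push_cast
    linarith

theorem bias_le_of_le {y : ℕ} (h : y ≤ n) : bias p c (gain p c n) n y ≤ c := by
  refine (bias_monotone hp hp1 hl h).trans ?_
  rw [bias_of_ge hp le_rfl]
  have h1 : 0 ≤ 1 / p := by positivity
  nlinarith

omit hp1 hl in
include hu in
theorem le_bias_of_lt {y : ℕ} (h : n < y) : c ≤ bias p c (gain p c n) n y := by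
  rw [bias_of_ge hp h.le]
  have h1 : 0 ≤ 1 / p := by positivity
  have h2 : (n : ℝ) + 1 ≤ y := by exact_mod_cast h
  nlinarith

include hu in
theorem bias_nonneg (hc : 0 ≤ c) (y : ℕ) : 0 ≤ bias p c (gain p c n) n y := by
  rcases le_or_gt y n with h | h
  · rw [bias_of_le h]
    have h1 : 1 ≤ 1 / p := by rwa [le_div_iff₀ hp, one_mul]
    have h2 : (y : ℝ) ≤ n := by exact_mod_cast h
    have h3 : (0 : ℝ) ≤ y := by positivity
    nlinarith
  · exact hc.trans (le_bias_of_lt hp hu h)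

theorem bias_le_linear (y : ℕ) :
    bias p c (gain p c n) n y ≤ c + (y + 1 / p) * (1 / p) := by
  have h1 : 0 ≤ 1 / p := by positivity
  rcases le_or_gt y n with h | h
  · have : 0 ≤ ((y : ℝ) + 1 / p) * (1 / p) := by positivity
    linarith [bias_le_of_le hp hp1 hl h]
  · rw [bias_of_ge hp h.le]
    nlinarith [gain_nonneg hp hl]

include hu in
theorem bias_eq (y : ℕ) :
    bias p c (gain p c n) n y = y + 1 - gain p c n + (1 - p) * bias p c (gain p c n) n (y + 1) +
      p * min (bias p c (gain p c n) n (y + 1)) c := by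
  rcases lt_or_ge y n with h | h
  · rw [min_eq_left (bias_le_of_le hp hp1 hl h), bias_of_le h.le, bias_of_le (y := y + 1) h]
    push_cast
    ring
  · rw [min_eq_right (le_bias_of_lt hp hu (by omega)), bias_of_ge hp h,
      bias_of_ge hp (y := y + 1) (by omega)]
    push_cast
    field_simp
    ring

include hu in
/-- If waiting for the next write is worse in `(x + 1, y + 1)` than sampling at once, then the age
difference is large. -/
theorem age_gap_of_bias_lt (hc : 0 ≤ c) {x y : ℕ}
    (h : bias p c (gain p c n) n (x + 1) + c < bias p c (gain p c n) n (y + 1)) :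
    p * min (bias p c (gain p c n) n (x + 1)) c < y - x := by
  have hny : n < y + 1 := by
    by_contra! hy
    linarith [bias_le_of_le hp hp1 hl hy, bias_nonneg hp hp1 hl hu hc (x + 1)]
  rw [bias_of_ge hp hny.le] at h
  have hpp : p * (1 / p) = 1 := mul_one_div_cancel hp.ne'
  -- For `x + 1 ≤ n`, multiplying `h` by `p` gives `p f(x + 1) < y + 1 + 1/p - g ≤ y + 1 - n ≤ y -
  -- x`. Otherwise both values are on the linear branch, and `h` says `c < (y - x)/p`.
  rcases le_or_gt (x + 1) n with hx | hx
  · have h2 : ((x + 1 : ℕ) : ℝ) ≤ n := by exact_mod_cast hx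
    have h3 := mul_lt_mul_of_pos_left h hp
    have h4 := mul_le_mul_of_nonneg_left (min_le_left (bias p c (gain p c n) n (x + 1)) c) hp.le
    have h5 : p * (c + (((y + 1 : ℕ) : ℝ) + 1 / p - gain p c n) * (1 / p)) =
        p * c + (((y + 1 : ℕ) : ℝ) + 1 / p - gain p c n) := by
      linear_combination (((y + 1 : ℕ) : ℝ) + 1 / p - gain p c n) * hpp
    rw [h5] at h3
    push_cast at *
    linarith
  · rw [bias_of_ge hp hx.le] at h
    rw [min_eq_right (le_bias_of_lt hp hu hx)]
    have h3 := mul_lt_mul_of_pos_left h hp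
    have h6 : ((y : ℝ) - x) = p * (((y : ℝ) - x) * (1 / p)) := by
      linear_combination -((y : ℝ) - x) * hpp
    rw [h6]
    refine mul_lt_mul_of_pos_left ?_ hp
    push_cast at h
    linarith

end Bias

/-! ### The two-dimensional optimality and Poisson equations -/

section Value

/-- The relative value function: in `(x, y)` either wait for the next write or sample at once. -/
noncomputable def value (p c : ℝ) (n : ℕ) (s : State) : ℝ :=
  ((s.2 : ℕ) : ℝ) + min (bias p c (gain p c n) n s.2) (bias p c (gain p c n) n s.1 + c)

/-- The relative value function of the policy with threshold `Y`. -/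
noncomputable def thresholdValue (p c : ℝ) (n Y : ℕ) (s : State) : ℝ :=
  ((s.2 : ℕ) : ℝ) + if s.1 = 0 ∧ Y ≤ (s.2 : ℕ) then c else bias p c (gain p c n) n s.2

variable {p c : ℝ} {n : ℕ} (hp : 0 < p) (hp1 : p ≤ 1) (hc : 0 ≤ c)
  (hl : n + 1 / p ≤ gain p c n) (hu : gain p c n ≤ n + 1 + 1 / p)

include hp hp1 hc hl hu

theorem value_nonneg (s : State) : 0 ≤ value p c n s := by
  have h1 := bias_nonneg hp hp1 hl hu hc s.1
  have h2 := bias_nonneg hp hp1 hl hu hc s.2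
  unfold value
  positivity

theorem thresholdValue_nonneg (Y : ℕ) (s : State) : 0 ≤ thresholdValue p c n Y s := by
  have h2 := bias_nonneg hp hp1 hl hu hc s.2
  unfold thresholdValue
  split_ifs <;> positivity

omit hc hu in
theorem value_le_linear (s : State) :
    value p c n s ≤ (1 + |c| + 1 / p + (1 / p) ^ 2) * (((s.2 : ℕ) : ℝ) + 1) := by
  have h1 := (min_le_left _ (bias p c (gain p c n) n s.1 + c)).trans
    (bias_le_linear hp hp1 hl s.2)
  have h2 : (0 : ℝ) ≤ (s.2 : ℕ) := by positivity
  have h3 : 0 ≤ 1 / p := by positivity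
  have h4 := le_abs_self c
  have h5 := abs_nonneg c
  unfold value
  nlinarith [mul_nonneg h2 h5, mul_nonneg h2 (sq_nonneg (1 / p))]

/-- After sampling, the age is `x + 1` whether or not a write occurs, and a second sample would not
help: the continuation is that of idling at age `x`. -/
theorem sample_advantage (s : State) :
    cost c s true + nextMean p (value p c n) s true - gain p c n =
      ((s.2 : ℕ) : ℝ) + (bias p c (gain p c n) n s.1 + c) := by
  obtain ⟨x, y⟩ := s
  have h := bias_eq hp hp1 hl hu x
  have h0 : min (bias p c (gain p c n) n (x + 1)) (bias p c (gain p c n) n (x + 1) + c) =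
      bias p c (gain p c n) n (x + 1) := min_eq_left (by linarith)
  simp only [cost, nextMean, nextState, value, if_true, Bool.false_eq_true, if_false,
    Nat.succPNat_coe, Nat.succ_eq_add_one, bias_zero, zero_add, h0]
  push_cast
  linear_combination -h

omit hc in
theorem idle_advantage_of_le {x : ℕ} {y : ℕ+}
    (h : bias p c (gain p c n) n (y + 1) ≤ bias p c (gain p c n) n (x + 1) + c) :
    cost c (x, y) false + nextMean p (value p c n) (x, y) false - gain p c n =
      (y : ℕ) + bias p c (gain p c n) n y := by
  have h1 := bias_eq hp hp1 hl hu y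
  simp only [cost, nextMean, nextState, value, if_true, Bool.false_eq_true, if_false,
    PNat.add_coe, PNat.val_ofNat, bias_zero, zero_add, min_eq_left h]
  push_cast
  linear_combination -h1

/-- Here sampling is preferred in both successor states. Idling instead of sampling now then loses
exactly `y - x - p * min (f (x + 1)) c`, positive by `age_gap_of_bias_lt`. -/
theorem idle_advantage_of_lt {x : ℕ} {y : ℕ+}
    (h : bias p c (gain p c n) n (x + 1) + c < bias p c (gain p c n) n (y + 1)) :
    (y : ℕ) + (bias p c (gain p c n) n x + c) <
      cost c (x, y) false + nextMean p (value p c n) (x, y) false - gain p c n := by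
  have h1 := bias_eq hp hp1 hl hu x
  have h2 := age_gap_of_bias_lt hp hp1 hl hu hc h
  have h3 := bias_nonneg hp hp1 hl hu hc (x + 1)
  have h4 : min (bias p c (gain p c n) n (y + 1)) c = c := min_eq_right (by linarith)
  simp only [cost, nextMean, nextState, value, if_true, Bool.false_eq_true, if_false,
    PNat.add_coe, PNat.val_ofNat, bias_zero, zero_add, min_eq_right h.le, h4]
  push_cast
  linarith

/-- `value` is a subsolution of the average-cost optimality equation. -/
theorem value_subsolution (s : State) (a : Action) :
    gain p c n + value p c n s ≤ cost c s a + nextMean p (value p c n) s a := by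
  cases a with
  | true =>
    have := sample_advantage hp hp1 hc hl hu s
    have h := min_le_right (bias p c (gain p c n) n s.2) (bias p c (gain p c n) n s.1 + c)
    unfold value at this ⊢
    linarith
  | false =>
    obtain ⟨x, y⟩ := s
    rcases le_or_gt (bias p c (gain p c n) n (y + 1)) (bias p c (gain p c n) n (x + 1) + c)
      with h | h
    · have := idle_advantage_of_le hp hp1 hl hu h
      have h := min_le_left (bias p c (gain p c n) n y) (bias p c (gain p c n) n x + c)
      unfold value at this ⊢
      linarith
    · have := idle_advantage_of_lt hp hp1 hc hl hu h
      have h := min_le_right (bias p c (gain p c n) n y) (bias p c (gain p c n) n x + c)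
      unfold value at this ⊢
      linarith

theorem value_lt_of_sample {y : ℕ+} (h : bias p c (gain p c n) n y < c) :
    gain p c n + value p c n (0, y) <
      cost c (0, y) true + nextMean p (value p c n) (0, y) true := by
  have h1 := sample_advantage hp hp1 hc hl hu (0, y)
  have h2 := min_le_left (bias p c (gain p c n) n y) (bias p c (gain p c n) n 0 + c)
  simp only [bias_zero, zero_add] at h1 h2
  simp only [value, bias_zero, zero_add] at h1 ⊢
  linarith

theorem value_lt_of_idle {y : ℕ+} (h : c < bias p c (gain p c n) n y) :
    gain p c n + value p c n (0, y) <
      cost c (0, y) false + nextMean p (value p c n) (0, y) false := by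
  have h2 := min_le_right (bias p c (gain p c n) n y) (bias p c (gain p c n) n 0 + c)
  rcases le_or_gt (bias p c (gain p c n) n (y + 1)) (bias p c (gain p c n) n (0 + 1) + c)
    with h' | h'
  · have h1 := idle_advantage_of_le hp hp1 hl hu h'
    simp only [bias_zero, zero_add] at h1 h2
    simp only [value, bias_zero, zero_add] at h1 ⊢
    linarith
  · have h1 := idle_advantage_of_lt hp hp1 hc hl hu h'
    simp only [bias_zero, zero_add] at h1 h2
    simp only [value, bias_zero, zero_add] at h1 ⊢
    linarith

omit hc in
/-- `thresholdValue` solves the Poisson equation of the policy with threshold `Y`. -/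
theorem thresholdValue_poisson {Y : ℕ}
    (hlow : ∀ y, y < Y → bias p c (gain p c n) n y ≤ c)
    (hhigh : ∀ y, Y ≤ y → c ≤ bias p c (gain p c n) n y) (s : State) :
    cost c s (thresholdPolicy Y s) + nextMean p (thresholdValue p c n Y) s (thresholdPolicy Y s) =
      gain p c n + thresholdValue p c n Y s := by
  obtain ⟨x, y⟩ := s
  have hmin : ∀ z : ℕ, (if Y ≤ z then c else bias p c (gain p c n) n z) =
      min (bias p c (gain p c n) n z) c := fun z => by
    split_ifs with h
    · exact (min_eq_right (hhigh z h)).symm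
    · exact (min_eq_left (hlow z (by omega))).symm
  by_cases h : x = 0 ∧ Y ≤ (y : ℕ)
  · have h1 := bias_eq hp hp1 hl hu 0
    obtain ⟨rfl, hy⟩ := h
    simp only [thresholdPolicy, cost, nextMean, nextState, thresholdValue, hy, hmin, if_true,
      Bool.false_eq_true, if_false, Nat.succPNat_coe, Nat.succ_eq_add_one, bias_zero, zero_add,
      true_and, decide_true, and_true, one_ne_zero, false_and] at h1 ⊢
    push_cast at h1 ⊢
    linear_combination -h1
  · have h1 := bias_eq hp hp1 hl hu y
    simp only [thresholdPolicy, cost, nextMean, nextState, thresholdValue, h, hmin, if_true,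
      Bool.false_eq_true, if_false, PNat.add_coe, PNat.val_ofNat,
      true_and, decide_false, Nat.add_eq_zero_iff, one_ne_zero, and_false, false_and] at h1 ⊢
    push_cast at h1 ⊢
    linear_combination -h1

end Value

/-! ### Strict loss at a recurrent state -/

section Recurrence

/-- A bound on the number of slots with a write after which a policy with threshold `k` or
`k + 1` is in the state `(0, k)`. -/
def writesToReach (k : ℕ) (s : State) : ℕ :=
  if s.1 = 0 then (if (s.2 : ℕ) ≤ k then k - s.2 else k) else k + 1

theorem writesToReach_le (k : ℕ) (s : State) : writesToReach k s ≤ k + 1 := by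
  unfold writesToReach
  split_ifs <;> omega

/-- Under successive writes the memory age is `0`: ages below `k` idle upwards one by one, and ages
above `k` are sampled and restart at `1`. The action at `k` itself depends on `Y`, hence the
exclusion. -/
theorem writesToReach_next_lt {π : State → Action} {Y k : ℕ} (hπ : HasThreshold π Y)
    (hk : 1 ≤ k) (hkY : k ≤ Y) (hYk : Y ≤ k + 1) {s : State}
    (hs : s.1 = 0 → (s.2 : ℕ) ≠ k) :
    writesToReach k (nextState s (π s) true) + 1 ≤ writesToReach k s := by
  obtain ⟨x, y⟩ := s
  by_cases hx : x = 0
  · subst hx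
    have hy : (y : ℕ) ≠ k := hs rfl
    have hy1 := y.pos
    cases hπy : π (0, y) with
    | true =>
      have := (hπ y).1 hπy
      have h1 : ¬ (y : ℕ) ≤ k := by omega
      simp [writesToReach, nextState, h1, hk]
    | false =>
      have : ¬ Y ≤ (y : ℕ) := fun h => by simp [(hπ y).2 h] at hπy
      have h1 : (y : ℕ) ≤ k := by omega
      have h2 : (y : ℕ) + 1 ≤ k := by omega
      simp [writesToReach, nextState, h1, h2]
      omega
  · simp only [writesToReach, nextState, hx, if_true, if_false]
    split_ifs <;> omega

/-- A policy with threshold `k` or `k + 1` visits `(0, k)` with positive frequency, so that an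
action with positive loss in this state makes its average cost larger. -/
theorem lt_averageCost_of_loss {p : unitInterval} (hp : 0 < (p : ℝ)) {c : ℝ} (hc : 0 ≤ c)
    {h : State → ℝ} (hh : ∀ s, 0 ≤ h s) {g K : ℝ} (hg : 0 ≤ g) (hK : 0 ≤ K)
    (hlin : ∀ s : State, h s ≤ K * (((s.2 : ℕ) : ℝ) + 1))
    (hsub : ∀ s a, g + h s ≤ cost c s a + nextMean p h s a)
    {π : State → Action} {Y : ℕ} {k : ℕ+} (hπ : HasThreshold π Y) (hkY : (k : ℕ) ≤ Y)
    (hYk : Y ≤ k + 1)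
    (hloss : g + h (0, k) < cost c (0, k) (π (0, k)) + nextMean p h (0, k) (π (0, k)))
    (s₀ : State) :
    ENNReal.ofReal g < averageCost p c (stationary π) s₀ := by
  have hp1 : (p : ℝ) ≤ 1 := p.2.2
  -- The subsolution `h` is perturbed by `b = M q ^ r`, with `r` the number of writes to reach `(0,
  -- k)`. There the loss `2 M` pays for `b ≤ M`. Elsewhere a write, of probability `p = 2 q`, lowers
  -- `r`, so the mean of `b` at least doubles. Either way `ε` is gained.
  set M := (cost c (0, k) (π (0, k)) + nextMean p h (0, k) (π (0, k)) - (g + h (0, k))) / 2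
    with hM
  have hM0 : 0 < M := by rw [hM]; linarith
  set q := (p : ℝ) / 2 with hq
  have hq0 : 0 < q := by positivity
  have hq1 : q ≤ 1 := by linarith
  set b : State → ℝ := fun s => M * q ^ writesToReach k s with hb
  set ε := M * q ^ ((k : ℕ) + 1) with hε
  have hε0 : 0 < ε := by positivity
  have hb0 : ∀ s, 0 ≤ b s := fun s => by positivity
  have hbM : ∀ s, b s ≤ M := fun s => mul_le_of_le_one_right hM0.le (pow_le_one₀ hq0.le hq1)
  have hbε : ∀ s, ε ≤ b s := fun s =>
    mul_le_mul_of_nonneg_left (pow_le_pow_of_le_one hq0.le hq1 (writesToReach_le k s)) hM0.le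
  have hεM : ε ≤ M := (hbε s₀).trans (hbM s₀)
  refine lt_of_lt_of_le ((ENNReal.ofReal_lt_ofReal_iff (by linarith)).2
    (show g < g + ε by linarith)) ?_
  refine le_averageCost_of_subsolution hc (h := fun s => h s + b s) (K := K + M)
    (fun s => add_nonneg (hh s) (hb0 s)) (by linarith) (by linarith) (fun s => ?_) ?_
  · have : (0 : ℝ) ≤ (s.2 : ℕ) := by positivity
    nlinarith [hlin s, hbM s]
  · intro l s a ha
    obtain rfl : a = π s := by
      by_contra hne
      exact ha (by simp [stationary, PMF.pure_apply, hne])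
    have hadd : nextMean p (fun s => h s + b s) s (π s) =
        nextMean p h s (π s) + nextMean p b s (π s) := by
      unfold nextMean; ring
    rw [hadd]
    by_cases hs : s.1 = 0 ∧ (s.2 : ℕ) = k
    · obtain rfl : s = (0, k) := Prod.ext hs.1 (PNat.coe_injective hs.2)
      have h1 : ε ≤ nextMean p b (0, k) (π (0, k)) := by
        unfold nextMean
        nlinarith [hbε (nextState (0, k) (π (0, k)) true),
          hbε (nextState (0, k) (π (0, k)) false)]
      have h2 := hbM (0, k)
      linarith
    · have hr := writesToReach_next_lt hπ k.pos hkY hYk (s := s) fun h0 h1 => hs ⟨h0, h1⟩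
      have h1 : 2 * b s ≤ p * b (nextState s (π s) true) := by
        have h3 : q ^ writesToReach k s ≤
            q ^ (writesToReach k (nextState s (π s) true) + 1) :=
          pow_le_pow_of_le_one hq0.le hq1 hr
        have h4 := mul_le_mul_of_nonneg_left h3 hM0.le
        have h5 : M * q ^ (writesToReach k (nextState s (π s) true) + 1) =
            p / 2 * b (nextState s (π s) true) := by
          rw [hb, pow_succ, ← hq]; ring
        change 2 * (M * q ^ writesToReach k s) ≤ _
        linarith
      have h2 : 0 ≤ (1 - (p : ℝ)) * b (nextState s (π s) false) :=
        mul_nonneg (by linarith) (hb0 _)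
      have h3 : nextMean p b s (π s) = p * b (nextState s (π s) true) +
        (1 - (p : ℝ)) * b (nextState s (π s) false) := rfl
      linarith [hsub s (π s), hbε s]

end Recurrence

theorem hasThreshold_thresholdPolicy (Y : ℕ) : HasThreshold (thresholdPolicy Y) Y := by
  intro y
  simp [thresholdPolicy]

theorem thresholdPolicy_max_one (Y : ℕ) : thresholdPolicy (max Y 1) = thresholdPolicy Y := by
  funext s
  have := s.2.pos
  simp only [thresholdPolicy, max_le_iff]
  congr 1
  simp only [eq_iff_iff, and_congr_right_iff]
  omega

/-! ### Optimal thresholds and the main theorem -/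

section Optimality

variable {p : unitInterval} {c : ℝ} {n : ℕ} (hp : 0 < (p : ℝ)) (hc : 0 ≤ c)
  (hl : n + 1 / (p : ℝ) ≤ gain p c n) (hu : gain p c n ≤ n + 1 + 1 / (p : ℝ))

include hp hc hl hu

theorem gain_le_averageCost (π : Policy) (s : State) :
    ENNReal.ofReal (gain p c n) ≤ averageCost p c π s :=
  le_averageCost_of_subsolution hc (value_nonneg hp p.2.2 hc hl hu) (gain_nonneg hp hl)
    (by positivity) (value_le_linear hp p.2.2 hl)
    fun _ s a _ => value_subsolution hp p.2.2 hc hl hu s a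

theorem averageCost_thresholdPolicy {Y : ℕ}
    (hlow : ∀ y, y < Y → bias p c (gain p c n) n y ≤ c)
    (hhigh : ∀ y, Y ≤ y → c ≤ bias p c (gain p c n) n y) (s : State) :
    averageCost p c (stationary (thresholdPolicy Y)) s = ENNReal.ofReal (gain p c n) := by
  refine le_antisymm ?_ (gain_le_averageCost hp hc hl hu _ s)
  refine averageCost_le_of_supersolution hc (thresholdValue_nonneg hp p.2.2 hc hl hu Y)
    (gain_nonneg hp hl) fun l s a ha => ?_
  obtain rfl : a = thresholdPolicy Y s := by
    by_contra hne
    exact ha (by simp [stationary, PMF.pure_apply, hne])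
  exact (thresholdValue_poisson hp p.2.2 hl hu hlow hhigh s).le

theorem averageCost_thresholdPolicy_succ (s : State) :
    averageCost p c (stationary (thresholdPolicy (n + 1))) s = ENNReal.ofReal (gain p c n) :=
  averageCost_thresholdPolicy hp hc hl hu
    (fun _ hy => bias_le_of_le hp p.2.2 hl (Nat.lt_succ_iff.1 hy))
    (fun _ hy => le_bias_of_lt hp hu hy) s

/-- The thresholds of the optimal policies, in terms of `bias`. -/
theorem exists_optimal_threshold_iff {Y : ℕ} (hY : 1 ≤ Y) :
    (∃ π : State → Action, IsAverageCostOptimal p c π ∧ HasThreshold π Y) ↔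
      bias p c (gain p c n) n (Y - 1) ≤ c ∧ c ≤ bias p c (gain p c n) n Y := by
  have hmono := bias_monotone hp p.2.2 hl
  constructor
  · rintro ⟨π, hopt, hπ⟩
    have hno : ∀ k : ℕ+, (k : ℕ) ≤ Y → Y ≤ k + 1 →
        ¬ gain p c n + value p c n (0, k) < cost c (0, k) (π (0, k)) +
          nextMean p (value p c n) (0, k) (π (0, k)) := fun k hkY hYk hloss => by
      have h1 := lt_averageCost_of_loss hp hc (value_nonneg hp p.2.2 hc hl hu)
        (gain_nonneg hp hl) (by positivity) (value_le_linear hp p.2.2 hl)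
        (value_subsolution hp p.2.2 hc hl hu) hπ hkY hYk hloss (0, 1)
      have h2 := hopt (0, 1) (stationary (thresholdPolicy (n + 1)))
      rw [averageCost_thresholdPolicy_succ hp hc hl hu] at h2
      exact absurd h1 (not_lt.2 h2)
    constructor
    · by_contra! h
      have hk : 0 < Y - 1 := by
        by_contra! h0
        rw [Nat.le_zero.1 h0, bias_zero] at h
        linarith
      have hidle : π (0, ⟨Y - 1, hk⟩) = false := by
        rw [Bool.eq_false_iff]
        intro ht
        have := (hπ ⟨Y - 1, hk⟩).1 ht
        simp only [PNat.mk_coe] at this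
        omega
      refine hno ⟨Y - 1, hk⟩ (by simp) (by simp only [PNat.mk_coe]; omega) ?_
      rw [hidle]
      exact value_lt_of_idle hp p.2.2 hc hl hu h
    · by_contra! h
      have hsample : π (0, ⟨Y, hY⟩) = true := (hπ ⟨Y, hY⟩).2 le_rfl
      refine hno ⟨Y, hY⟩ le_rfl (by simp) ?_
      rw [hsample]
      exact value_lt_of_sample hp p.2.2 hc hl hu h
  · rintro ⟨hlow, hhigh⟩
    refine ⟨thresholdPolicy Y, fun s π' => ?_, hasThreshold_thresholdPolicy Y⟩
    rw [averageCost_thresholdPolicy hp hc hl hu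
      (fun y hy => (hmono (by omega)).trans hlow) (fun y hy => hhigh.trans (hmono hy))]
    exact gain_le_averageCost hp hc hl hu π' s

end Optimality

/-- The equation that determines the real threshold from the sampling cost. -/
theorem threshold_nonneg_and_eq {P c Y' : ℝ} (hc : 0 ≤ c)
    (hY' : Y' = Real.sqrt (2 * c + (P - 1 / 2) ^ 2) - (P - 1 / 2)) :
    0 ≤ Y' ∧ c = Y' * P + Y' * (Y' - 1) / 2 := by
  have h0 : 0 ≤ 2 * c + (P - 1 / 2) ^ 2 := by positivity
  have h1 : P - 1 / 2 ≤ Real.sqrt (2 * c + (P - 1 / 2) ^ 2) := Real.le_sqrt_of_sq_le (by linarith)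
  have h2 := Real.sq_sqrt h0
  refine ⟨by linarith, ?_⟩
  rw [show Real.sqrt (2 * c + (P - 1 / 2) ^ 2) = Y' + (P - 1 / 2) by linarith] at h2
  linarith

end MemorySampling

open MemorySampling

theorem mainTheorem1 (p : unitInterval) (hp : 0 < p) (c : ℝ) (hc : 0 ≤ c)
    (Y' : ℝ)
    (hY' : Y' = Real.sqrt (2 * c + (1 / (p : ℝ) - 1 / 2) ^ 2) - (1 / (p : ℝ) - 1 / 2)) :
    -- the threshold policy with threshold `⌈Y'⌉` is average-cost optimal
    MemorySampling.IsAverageCostOptimal p c (MemorySampling.thresholdPolicy ⌈Y'⌉₊) ∧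
    -- it samples in `(0, y)` exactly when `y ≥ ⌈Y'⌉`
    MemorySampling.HasThreshold (MemorySampling.thresholdPolicy ⌈Y'⌉₊) ⌈Y'⌉₊ ∧
    -- its average cost is finite and the same for every initial state
    (∃ g : ℝ≥0, ∀ s : MemorySampling.State,
      MemorySampling.averageCost p c
        (MemorySampling.stationary (MemorySampling.thresholdPolicy ⌈Y'⌉₊)) s = (g : ℝ≥0∞)) ∧
    -- the thresholds of average-cost optimal policies: `⌈Y'⌉`, and its successor in case of a tie
    (∀ Y : ℕ, 1 ≤ Y →
      ((∃ π : MemorySampling.State → MemorySampling.Action,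
          MemorySampling.IsAverageCostOptimal p c π ∧ MemorySampling.HasThreshold π Y) ↔
        Y = ⌈Y'⌉₊ ∨ (Y' = (⌈Y'⌉₊ : ℝ) ∧ Y = ⌈Y'⌉₊ + 1))) := by
  have hp0 : 0 < (p : ℝ) := hp
  have hP : 1 ≤ 1 / (p : ℝ) := by rw [le_div_iff₀ hp0, one_mul]; exact p.2.2
  obtain ⟨hY0, hcY⟩ := threshold_nonneg_and_eq hc hY'
  clear hY'
  set P := 1 / (p : ℝ) with hPdef
  -- The maximum with `1` covers `c = 0`, where `⌈Y'⌉₊ = 0` but thresholds `0` and `1` give the same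
  -- policy.
  obtain ⟨n, hn⟩ : ∃ n, max ⌈Y'⌉₊ 1 = n + 1 := ⟨max ⌈Y'⌉₊ 1 - 1, by omega⟩
  have hceil := Nat.ceil_lt_add_one hY0
  have hY'n : Y' ≤ n + 1 := (Nat.le_ceil Y').trans (by
    exact_mod_cast (le_max_left _ _).trans hn.le)
  have hnY' : (n : ℝ) ≤ Y' := by
    rcases Nat.eq_zero_or_pos n with rfl | h0
    · simpa using hY0
    · have h1 : ⌈Y'⌉₊ = n + 1 := by omega
      rw [h1] at hceil
      push_cast at hceil
      linarith
  have hn0 : (0 : ℝ) ≤ n := by positivity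
  have hnP : 0 < n + P := by linarith
  have hlow := gain_sub_lower (c := c) (n := n) hp0
  have hupp := upper_sub_gain (c := c) (n := n) hp0
  rw [← hPdef] at hlow hupp
  have hlow' : (gain p c n - (n + P)) * (n + P) = (Y' - n) * (P + (Y' + n - 1) / 2) := by
    rw [hlow, hcY]; ring
  have hupp' : (n + 1 + P - gain p c n) * (n + P) = (n + 1 - Y') * (P + (Y' + n) / 2) := by
    rw [hupp, hcY]; ring
  have hl : n + P ≤ gain p c n := by
    refine sub_nonneg.1 (nonneg_of_mul_nonneg_left ?_ hnP)
    rw [hlow']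
    exact mul_nonneg (by linarith) (by linarith)
  have hu : gain p c n ≤ n + 1 + P := by
    refine sub_nonneg.1 (nonneg_of_mul_nonneg_left ?_ hnP)
    rw [hupp']
    exact mul_nonneg (by linarith) (by linarith)
  have havg : ∀ s, averageCost p c (stationary (thresholdPolicy ⌈Y'⌉₊)) s =
      ENNReal.ofReal (gain p c n) := fun s => by
    rw [← thresholdPolicy_max_one, hn]
    exact averageCost_thresholdPolicy_succ hp0 hc hl hu s
  refine ⟨fun s π' => ?_, hasThreshold_thresholdPolicy _, ⟨(gain p c n).toNNReal, havg⟩,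
    fun Y hY => ?_⟩
  · rw [havg]
    exact gain_le_averageCost hp0 hc hl hu π' s
  have hmono := bias_monotone hp0 p.2.2 hl
  -- For `Y' = 0` the threshold `1 = n + 1` comes from the tie clause on the left, and the tie
  -- clause on the right is void.
  have hthr : (Y = ⌈Y'⌉₊ ∨ (Y' = (⌈Y'⌉₊ : ℝ) ∧ Y = ⌈Y'⌉₊ + 1)) ↔
      Y = n + 1 ∨ (Y' = n + 1 ∧ Y = n + 2) := by
    rcases Nat.eq_zero_or_pos ⌈Y'⌉₊ with h0 | h0
    · have hn' : n = 0 := by omega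
      have hz : Y' = 0 := le_antisymm (Nat.ceil_eq_zero.1 h0) hY0
      rw [h0, hn', hz]
      constructor
      · rintro (h | ⟨-, h⟩)
        · omega
        · exact Or.inl h
      · rintro (h | ⟨h, -⟩)
        · exact Or.inr ⟨by simp, h⟩
        · norm_num at h
    · have hn' : ⌈Y'⌉₊ = n + 1 := by omega
      rw [hn']
      push_cast
      rfl
  rw [exists_optimal_threshold_iff hp0 hc hl hu hY, hthr]
  constructor
  · rintro ⟨h1, h2⟩
    -- If `Y ≤ n`, then `c ≤ f n` forces `g = n + 1/p`, hence `Y' = n`; by the choice of `n` this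
    -- leaves only `n = 0`, excluded by `Y ≥ 1`.
    have hYn : n + 1 ≤ Y := by
      by_contra! hlt
      have h3 := h2.trans (hmono (show Y ≤ n by omega))
      rw [bias_of_ge hp0 le_rfl] at h3
      have h4 : 0 ≤ n + P - gain p c n :=
        nonneg_of_mul_nonneg_left (by linarith) (show 0 < P by linarith)
      have h5 : Y' = n := by
        by_contra hne
        have h6 : (n : ℝ) < Y' := lt_of_le_of_ne hnY' (Ne.symm hne)
        have h7 : 0 < (Y' - n) * (P + (Y' + n - 1) / 2) :=
          mul_pos (by linarith) (by linarith)
        rw [← hlow'] at h7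
        nlinarith
      rw [h5, Nat.ceil_natCast] at hn
      omega
    rcases hYn.eq_or_lt with h | h
    · exact Or.inl h.symm
    have h3 := (hmono (show n + 1 ≤ Y - 1 by omega)).trans h1
    have hYn2 : Y ≤ n + 2 := by
      by_contra! hgt
      have h4 := (hmono (show n + 2 ≤ Y - 1 by omega)).trans h1
      rw [bias_of_ge hp0 (by omega)] at h4
      push_cast at h4
      nlinarith
    rw [bias_of_ge hp0 (by omega)] at h3
    push_cast at h3
    refine Or.inr ⟨?_, by omega⟩
    by_contra hne
    have h6 : Y' < n + 1 := lt_of_le_of_ne hY'n hne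
    have h7 : 0 < (n + 1 - Y') * (P + (Y' + n) / 2) := mul_pos (by linarith) (by linarith)
    rw [← hupp'] at h7
    have h8 : 0 < n + 1 + P - gain p c n := pos_of_mul_pos_left h7 hnP.le
    have h9 : 0 < (n + 1 + P - gain p c n) * P := mul_pos h8 (by linarith)
    linarith
  · rintro (rfl | ⟨h, rfl⟩)
    · exact ⟨bias_le_of_le hp0 p.2.2 hl le_rfl, le_bias_of_lt hp0 hu (Nat.lt_succ_self n)⟩
    · refine ⟨?_, le_bias_of_lt hp0 hu (by omega)⟩
      have h1 : gain p c n = n + 1 + P := by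
        rw [h, sub_self, zero_mul] at hupp'
        rcases mul_eq_zero.1 hupp' with h | h <;> linarith
      rw [show n + 2 - 1 = n + 1 from rfl, bias_of_ge hp0 (by omega), h1]
      push_cast
      rw [← hPdef]
      linarith
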